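/- Let $\Bbbk$ be an arbitrary field, let $n\ge 2$ and $t\ge 1$ be integers, and let $S=\Bbbk[x_1,\dots,x_n]$ with the standard grading. Let $J_{n,n-1}\subset S$ be the $(n-1)$-path ideal of the cycle of length $n$, that is, the ideal generated by the $n$ monomials $x_a x_{a+1}\cdots x_{a+n-2}$, $a=1,\dots,n$, with indices taken modulo $n$ (so $J_{2,1}=(x_1,x_2)$). Then $J_{n,n-1}^t$ has a linear free resolution, i.e. for some integer $d$ there is a graded free resolution $$\cdots\to S(-d-2)^{b_2}\to S(-d-1)^{b_1}\to S(-d)^{b_0}\to J_{n,n-1}^t\to 0$$ with all $b_i$ finite. Moreover, its Betti numbers $\beta_i(J_{n,n-1}^t)=\dim_\Bbbk \operatorname{Tor}_i^S(\Bbbk,J_{n,n-1}^t)$ are $$\beta_i(J_{n,n-1}^t)=\binom{n-1}{i}\binom{n+t-i-1}{t-i}\qquad\text{for all } i\ge 0,$$ where $\binom{a}{b}=0$ for $b<0$; in particular $\beta_i(J_{n,n-1}^t)=0$ for $i>t$. -/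

import Mathlib

/-- The generator `x_{a+1} x_{a+2} ⋯ x_{a+m}` (indices modulo `n`) attached to the path on `m`
consecutive vertices of the `n`-cycle starting at the vertex `a : Fin n`. -/
noncomputable def cyclePathMonomial (k : Type*) [Field k] (n m : ℕ) (a : Fin n) :
    MvPolynomial (Fin n) k :=
  ∏ j ∈ Finset.range m, MvPolynomial.X (⟨(a.val + j) % n, Nat.mod_lt _ a.pos⟩ : Fin n)

/-- The `m`-path ideal `J_{n,m}` of the cycle of length `n`, in `k[x_1, …, x_n]`. -/
noncomputable def cyclePathIdeal (k : Type*) [Field k] (n m : ℕ) :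
    Ideal (MvPolynomial (Fin n) k) :=
  Ideal.span (Set.range (cyclePathMonomial k n m))

/-- The `i`-th (total) Betti number `dim_k Tor_i^S(k, M)` of a module `M` over the polynomial ring
`S = k[x_1, …, x_n]`, as a cardinal. The `S`-module `k` is the quotient of `S` by the ideal
generated by the variables. -/
noncomputable def bettiNumber {k : Type*} [Field k] {n : ℕ} (i : ℕ)
    (M : ModuleCat (MvPolynomial (Fin n) k)) : Cardinal :=
  Module.rank k ((ModuleCat.restrictScalars (MvPolynomial.C : k →+* MvPolynomial (Fin n) k)).obj
    (((CategoryTheory.Tor (ModuleCat (MvPolynomial (Fin n) k)) i).obj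
      (ModuleCat.of (MvPolynomial (Fin n) k)
        (MvPolynomial (Fin n) k ⧸
          Ideal.span (Set.range (MvPolynomial.X : Fin n → MvPolynomial (Fin n) k))))).obj M))

/-- The ideal `I` of `S = k[x_1, …, x_n]` has a linear free resolution: for some `d` there is a
graded free resolution
`⋯ → S(-d-2)^{b_2} → S(-d-1)^{b_1} → S(-d)^{b_0} → I → 0`.
The augmentation is given by a finite family `g` of forms of degree `d` generating `I`, and the
differential `S(-d-i-1)^{b_{i+1}} → S(-d-i)^{b_i}` by a matrix `A i` of linear forms. -/
def HasLinearFreeResolution {k : Type*} [Field k] {n : ℕ}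
    (I : Ideal (MvPolynomial (Fin n) k)) : Prop :=
  ∃ (d : ℕ) (b : ℕ → ℕ) (g : Fin (b 0) → MvPolynomial (Fin n) k)
    (A : ∀ i : ℕ, Matrix (Fin (b i)) (Fin (b (i + 1))) (MvPolynomial (Fin n) k)),
    (∀ r, (g r).IsHomogeneous d) ∧
    (∀ i r s, (A i r s).IsHomogeneous 1) ∧
    Ideal.span (Set.range g) = I ∧
    Function.Exact (A 0).mulVecLin (Fintype.linearCombination (MvPolynomial (Fin n) k) g) ∧
    ∀ i, Function.Exact (A (i + 1)).mulVecLin (A i).mulVecLin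

/-! Put N = n - 1. A path on N vertices of the n-cycle omits exactly one vertex, so the ideal J is
generated by the products of all variables but one, which are proportional to the inverses of the
variables. The Rees algebra of J is S[T_0, …, T_N] modulo the N relations x_0 T_0 - x_j T_j, j ≥ 1.
These form a regular sequence: the ideal of the relations indexed by a set A containing 0 is the
kernel of a monomial map into a domain (`partialReesMap_eq_zero_iff`), hence prime, and it does not
contain the next relation (`mem_inverseRelIdeal_of_mul_mem`).

So the Koszul complex on the relations resolves the Rees algebra (`koszulMatrix_exact`). The
relations have degree 1 in T, so the part of T-degree t is an S-free resolution of J^t whose i-th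
term has rank binom(N, i) times the number of monomials of degree t - i in n variables. They are
also linear in x, so every matrix entry is a linear form. The resolution is thus linear, and its
differentials vanish after tensoring with k, so its ranks are the Betti numbers. -/

/-! ### The Koszul complex as an iterated mapping cone. -/

/-- The index set of the standard basis of the `i`-th term of the Koszul complex on `r` elements,
built as an iterated mapping cone. -/
def KoszulIndex : ℕ → ℕ → Type
  | 0, 0 => Unit
  | 0, _ + 1 => Empty
  | r + 1, 0 => KoszulIndex r 0
  | r + 1, i + 1 => KoszulIndex r (i + 1) ⊕ KoszulIndex r i

namespace KoszulIndex

instance instFintype : ∀ r i, Fintype (KoszulIndex r i)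
  | 0, 0 => inferInstanceAs (Fintype Unit)
  | 0, _ + 1 => inferInstanceAs (Fintype Empty)
  | r + 1, 0 => instFintype r 0
  | r + 1, i + 1 =>
    letI := instFintype r (i + 1)
    letI := instFintype r i
    inferInstanceAs (Fintype (KoszulIndex r (i + 1) ⊕ KoszulIndex r i))

instance instDecidableEq : ∀ r i, DecidableEq (KoszulIndex r i)
  | 0, 0 => inferInstanceAs (DecidableEq Unit)
  | 0, _ + 1 => inferInstanceAs (DecidableEq Empty)
  | r + 1, 0 => instDecidableEq r 0
  | r + 1, i + 1 =>
    letI := instDecidableEq r (i + 1)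
    letI := instDecidableEq r i
    inferInstanceAs (DecidableEq (KoszulIndex r (i + 1) ⊕ KoszulIndex r i))

theorem card_eq_choose : ∀ r i, Fintype.card (KoszulIndex r i) = r.choose i
  | 0, 0 => rfl
  | 0, _ + 1 => rfl
  | r + 1, 0 => (card_eq_choose r 0).trans (by simp)
  | r + 1, i + 1 => by
    have h : Fintype.card (KoszulIndex (r + 1) (i + 1)) =
        Fintype.card (KoszulIndex r (i + 1) ⊕ KoszulIndex r i) :=
      Fintype.card_congr (Equiv.refl _)
    rw [h, Fintype.card_sum, card_eq_choose, card_eq_choose, Nat.choose_succ_succ, add_comm]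

instance instUnique : ∀ r, Unique (KoszulIndex r 0)
  | 0 => inferInstanceAs (Unique Unit)
  | r + 1 => instUnique r

instance (i : ℕ) : IsEmpty (KoszulIndex 0 (i + 1)) := inferInstanceAs (IsEmpty Empty)

end KoszulIndex

section Koszul

variable {R : Type*} [CommRing R] (f : ℕ → R)

/-- The matrices of the differentials of the Koszul complex on `f 0, …, f (r - 1)`. -/
def koszulMatrix : ∀ r i, Matrix (KoszulIndex r i) (KoszulIndex r (i + 1)) R
  | 0, _ => 0
  | r + 1, 0 =>
    (Matrix.fromCols (koszulMatrix r 0) (f r • 1) :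
      Matrix (KoszulIndex r 0) (KoszulIndex r 1 ⊕ KoszulIndex r 0) R)
  | r + 1, i + 1 =>
    (Matrix.fromBlocks (koszulMatrix r (i + 1)) (f r • 1) 0 (-koszulMatrix r i) :
      Matrix (KoszulIndex r (i + 1) ⊕ KoszulIndex r i)
        (KoszulIndex r (i + 2) ⊕ KoszulIndex r (i + 1)) R)

theorem Matrix.smul_one_apply_mem {α : Type*} [DecidableEq α] (V : AddSubgroup R) {c : R}
    (hc : c ∈ V) (p q : α) : (c • (1 : Matrix α α R)) p q ∈ V := by
  rw [Matrix.smul_apply, Matrix.one_apply]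
  split_ifs <;> simp [hc, V.zero_mem]

/-- Every entry is 0 or some ± `f j`. Used for linearity in T and, separately, for linearity in x.
-/
theorem koszulMatrix_mem (V : AddSubgroup R) (hf : ∀ j, f j ∈ V) :
    ∀ r i p q, koszulMatrix f r i p q ∈ V
  | 0, _, _, _ => V.zero_mem
  | r + 1, 0, p, .inl q => koszulMatrix_mem V hf r 0 p q
  | r + 1, 0, _, .inr q => Matrix.smul_one_apply_mem V (hf r) _ q
  | r + 1, i + 1, .inl p, .inl q => koszulMatrix_mem V hf r (i + 1) p q
  | r + 1, _ + 1, .inl _, .inr q => Matrix.smul_one_apply_mem V (hf r) _ q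
  | _ + 1, _ + 1, .inr _, .inl _ => V.zero_mem
  | r + 1, i + 1, .inr p, .inr q => V.neg_mem (koszulMatrix_mem V hf r i p q)

theorem koszulMatrix_succ_zero_mulVec (r : ℕ) (a : KoszulIndex r 1 → R) (b : KoszulIndex r 0 → R) :
    (koszulMatrix f (r + 1) 0).mulVec (Sum.elim a b : KoszulIndex r 1 ⊕ KoszulIndex r 0 → R) =
      (koszulMatrix f r 0).mulVec a + f r • b := by
  refine (Matrix.fromCols_mulVec_sumElim (koszulMatrix f r 0)
    (f r • (1 : Matrix (KoszulIndex r 0) (KoszulIndex r 0) R)) a b).trans ?_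
  rw [Matrix.smul_mulVec, Matrix.one_mulVec]

theorem koszulMatrix_succ_succ_mulVec (r i : ℕ) (a : KoszulIndex r (i + 2) → R)
    (b : KoszulIndex r (i + 1) → R) :
    (koszulMatrix f (r + 1) (i + 1)).mulVec
        (Sum.elim a b : KoszulIndex r (i + 2) ⊕ KoszulIndex r (i + 1) → R) =
      (Sum.elim ((koszulMatrix f r (i + 1)).mulVec a + f r • b) (-(koszulMatrix f r i).mulVec b) :
        KoszulIndex r (i + 1) ⊕ KoszulIndex r i → R) := by
  refine (Matrix.fromBlocks_mulVec (koszulMatrix f r (i + 1)) (f r • 1) 0 (-koszulMatrix f r i)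
    (Sum.elim a b)).trans ?_
  simp only [Sum.elim_comp_inl, Sum.elim_comp_inr, Matrix.smul_mulVec, Matrix.one_mulVec,
    Matrix.zero_mulVec, Matrix.neg_mulVec, zero_add]

theorem mem_range_koszulMatrix_zero : ∀ (r : ℕ) (v : KoszulIndex r 0 → R),
    (∃ w, (koszulMatrix f r 0).mulVec w = v) ↔ v default ∈ Ideal.span (f '' Set.Iio r)
  | 0, v => by
    have h : (koszulMatrix f 0 0) = 0 := rfl
    have hI : Set.Iio 0 = (∅ : Set ℕ) := by ext; simp
    simp only [h, hI, Matrix.zero_mulVec, exists_const, Set.image_empty, Ideal.span_empty,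
      Ideal.mem_bot]
    constructor
    · rintro rfl; rfl
    · intro h; ext p; rw [Subsingleton.elim p default, h]; rfl
  | r + 1, v => by
    have hI : Set.Iio (r + 1) = insert r (Set.Iio r) := by
      ext x; simp
    rw [hI, Set.image_insert_eq, Ideal.mem_span_insert]
    constructor
    · rintro ⟨w, rfl⟩
      obtain ⟨a, b, rfl⟩ : ∃ (a : KoszulIndex r 1 → R) (b : KoszulIndex r 0 → R),
          (Sum.elim a b : KoszulIndex r 1 ⊕ KoszulIndex r 0 → R) = w :=
        ⟨_, _, Sum.elim_comp_inl_inr w⟩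
      rw [koszulMatrix_succ_zero_mulVec]
      refine ⟨b default, _, (mem_range_koszulMatrix_zero r _).1 ⟨a, rfl⟩, ?_⟩
      change (koszulMatrix f r 0).mulVec a default + f r * b default = _
      ring
    · rintro ⟨c, z, hz, h⟩
      obtain ⟨a, ha⟩ := (mem_range_koszulMatrix_zero r (fun _ => z)).2 hz
      refine ⟨(Sum.elim a (fun _ => c) : KoszulIndex r 1 ⊕ KoszulIndex r 0 → R), ?_⟩
      rw [koszulMatrix_succ_zero_mulVec, ha]
      ext p
      rw [Subsingleton.elim p default]
      refine Eq.trans ?_ h.symm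
      change z + f r * c = _
      ring

/-- The Koszul complex on a weakly regular sequence is exact in positive degrees. -/
theorem koszulMatrix_exact : ∀ (r : ℕ)
    (_ : ∀ j < r, ∀ g, f j * g ∈ Ideal.span (f '' Set.Iio j) → g ∈ Ideal.span (f '' Set.Iio j))
    (i : ℕ), Function.Exact (koszulMatrix f r (i + 1)).mulVec (koszulMatrix f r i).mulVec
  | 0, _, i => fun v => by
    constructor
    · intro _
      exact ⟨0, funext fun p => isEmptyElim (α := KoszulIndex 0 (i + 1)) p⟩
    · rintro ⟨w, rfl⟩
      have h : koszulMatrix f 0 i = 0 := rfl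
      rw [h, Matrix.zero_mulVec]
  | r + 1, hf, 0 => fun v => by
    have ih := koszulMatrix_exact r (fun j hj => hf j (by omega)) 0
    obtain ⟨a, b, rfl⟩ : ∃ (a : KoszulIndex r 1 → R) (b : KoszulIndex r 0 → R),
        (Sum.elim a b : KoszulIndex r 1 ⊕ KoszulIndex r 0 → R) = v :=
      ⟨_, _, Sum.elim_comp_inl_inr v⟩
    constructor
    · intro h
      rw [koszulMatrix_succ_zero_mulVec] at h
      -- The one use of regularity: `f r • b` is a boundary, so its coordinate lies in the ideal of
      -- the earlier elements, hence so does that of `b`.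
      obtain ⟨c, hc⟩ := (mem_range_koszulMatrix_zero f r b).2 <| hf r (by omega) _ <|
        (mem_range_koszulMatrix_zero f r (f r • b)).1
          ⟨-a, by rw [Matrix.mulVec_neg]; exact neg_eq_of_add_eq_zero_right h⟩
      obtain ⟨e, he⟩ := (ih (a + f r • c)).1 (by
        rw [Matrix.mulVec_add, Matrix.mulVec_smul, hc]; exact h)
      refine ⟨(Sum.elim e (-c) : KoszulIndex r 2 ⊕ KoszulIndex r 1 → R), ?_⟩
      rw [koszulMatrix_succ_succ_mulVec, he, Matrix.mulVec_neg, hc, smul_neg, neg_neg,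
        add_neg_cancel_right]
    · rintro ⟨w, hw⟩
      obtain ⟨c, e, rfl⟩ : ∃ (c : KoszulIndex r 2 → R) (e : KoszulIndex r 1 → R),
          (Sum.elim c e : KoszulIndex r 2 ⊕ KoszulIndex r 1 → R) = w :=
        ⟨_, _, Sum.elim_comp_inl_inr w⟩
      rw [← hw, koszulMatrix_succ_succ_mulVec, koszulMatrix_succ_zero_mulVec, Matrix.mulVec_add,
        (ih _).2 ⟨c, rfl⟩, Matrix.mulVec_smul, zero_add, smul_neg, add_neg_cancel]
      rfl
  | r + 1, hf, i + 1 => fun v => by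
    have ih := koszulMatrix_exact r (fun j hj => hf j (by omega)) (i + 1)
    have ih' := koszulMatrix_exact r (fun j hj => hf j (by omega)) i
    obtain ⟨a, b, rfl⟩ : ∃ (a : KoszulIndex r (i + 2) → R) (b : KoszulIndex r (i + 1) → R),
        (Sum.elim a b : KoszulIndex r (i + 2) ⊕ KoszulIndex r (i + 1) → R) = v :=
      ⟨_, _, Sum.elim_comp_inl_inr v⟩
    constructor
    · intro h
      rw [koszulMatrix_succ_succ_mulVec] at h
      have h1 : (koszulMatrix f r (i + 1)).mulVec a + f r • b = 0 :=
        funext fun p => congrFun h (Sum.inl p)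
      have h2 : -(koszulMatrix f r i).mulVec b = 0 :=
        funext fun p => congrFun h (Sum.inr p)
      -- Here exactness of the smaller complex one degree lower plays the role of regularity.
      obtain ⟨c, hc⟩ := (ih' b).1 (neg_eq_zero.1 h2)
      obtain ⟨e, he⟩ := (ih (a + f r • c)).1 (by
        rw [Matrix.mulVec_add, Matrix.mulVec_smul, hc]; exact h1)
      refine ⟨(Sum.elim e (-c) : KoszulIndex r (i + 3) ⊕ KoszulIndex r (i + 2) → R), ?_⟩
      rw [koszulMatrix_succ_succ_mulVec, he, Matrix.mulVec_neg, hc, smul_neg, neg_neg,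
        add_neg_cancel_right]
    · rintro ⟨w, hw⟩
      obtain ⟨c, e, rfl⟩ : ∃ (c : KoszulIndex r (i + 3) → R) (e : KoszulIndex r (i + 2) → R),
          (Sum.elim c e : KoszulIndex r (i + 3) ⊕ KoszulIndex r (i + 2) → R) = w :=
        ⟨_, _, Sum.elim_comp_inl_inr w⟩
      rw [← hw, koszulMatrix_succ_succ_mulVec, koszulMatrix_succ_succ_mulVec, Matrix.mulVec_add,
        (ih _).2 ⟨c, rfl⟩, Matrix.mulVec_smul, Matrix.mulVec_neg, (ih' _).2 ⟨e, rfl⟩]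
      rw [zero_add, smul_neg, add_neg_cancel, neg_zero, neg_zero]
      exact Sum.elim_zero_zero
end Koszul

/-! ### The degree t strand of a Koszul complex on linear forms. -/

section Strand

open MvPolynomial

variable {τ S : Type*} [CommRing S]

theorem MvPolynomial.coeff_mul_monomial_eq_zero {D : MvPolynomial τ S} (hD : D.IsHomogeneous 1)
    {m m' : τ →₀ ℕ} (h : m.degree ≠ m'.degree + 1) (c : S) :
    coeff m (D * monomial m' c) = 0 := by
  have := hD.mul (isHomogeneous_monomial c (n := m'.degree) rfl)
  exact this.coeff_eq_zero (by omega)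

/-- Multiplication by a linear form raises degree by one, so only the monomials of `w` of degree one
less than `m` contribute. -/
theorem MvPolynomial.coeff_linear_mul [Finite τ] {D : MvPolynomial τ S} (hD : D.IsHomogeneous 1)
    {i t : ℕ} [Fintype {m : τ →₀ ℕ // i + 1 + m.degree = t}] {m : τ →₀ ℕ} (hm : i + m.degree = t)
    (w : MvPolynomial τ S) :
    coeff m (D * w) = ∑ m' : {m : τ →₀ ℕ // i + 1 + m.degree = t},
      coeff m (D * monomial m'.1 1) * coeff m'.1 w := by
  classical
  induction w using MvPolynomial.induction_on' with
  | add p q hp hq => simp only [mul_add, coeff_add, hp, hq, Finset.sum_add_distrib]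
  | monomial u a =>
    by_cases hu : i + 1 + u.degree = t
    · rw [Finset.sum_eq_single ⟨u, hu⟩]
      · rw [coeff_monomial, if_pos rfl,
          (by rw [C_mul_monomial, mul_one] : monomial u a = C a * monomial u 1), mul_left_comm,
          coeff_C_mul, mul_comm]
      · intro b _ hb
        rw [coeff_monomial, if_neg (fun h => hb (Subtype.ext h.symm)), mul_zero]
      · simp
    · rw [coeff_mul_monomial_eq_zero hD (by omega), Finset.sum_eq_zero]
      intro b _
      rw [coeff_monomial, if_neg (by rintro rfl; exact hu b.2), mul_zero]

/-- The condition `i + m.degree = t` avoids truncated subtraction: no `m` satisfies it when i > t,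
so the strand stops at i = t. -/
instance Finsupp.finite_add_degree_eq [Finite τ] (i t : ℕ) :
    Finite {m : τ →₀ ℕ // i + m.degree = t} := by
  classical
  have := Fintype.ofFinite τ
  refine Set.Finite.to_subtype ((Finset.finite_toSet
    (Finset.finsuppAntidiag (Finset.univ : Finset τ) (t - i))).subset ?_)
  intro m hm
  have hm : i + m.degree = t := hm
  rw [Finset.mem_coe, Finset.mem_finsuppAntidiag]
  refine ⟨?_, Finset.subset_univ _⟩
  rw [← Finsupp.degree_eq_sum]
  omega

noncomputable instance [Finite τ] (i t : ℕ) : Fintype {m : τ →₀ ℕ // i + m.degree = t} :=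
  Fintype.ofFinite _

/-- The index set of the `i`-th term of the degree `t` strand of the Koszul complex on `r` linear
forms of a polynomial ring in the variables `τ`. -/
abbrev StrandIndex (τ : Type*) (r i t : ℕ) : Type _ :=
  KoszulIndex r i × {m : τ →₀ ℕ // i + m.degree = t}

/-- The differential of the degree `t` strand of the Koszul complex on `f 0, …, f (r - 1)`. -/
noncomputable def strandMatrix (f : ℕ → MvPolynomial τ S) (r i t : ℕ) :
    Matrix (StrandIndex τ r i t) (StrandIndex τ r (i + 1) t) S :=
  fun p q => coeff p.2.1 (koszulMatrix f r i p.1 q.1 * monomial q.2.1 1)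

/-- The coefficients of a vector of polynomials in the degree `t` strand. -/
def toStrand {r i t : ℕ} (w : KoszulIndex r i → MvPolynomial τ S) : StrandIndex τ r i t → S :=
  fun p => coeff p.2.1 (w p.1)

/-- The vector of polynomials with given coefficients in the degree `t` strand. -/
noncomputable def ofStrand [Finite τ] {r i t : ℕ} (v : StrandIndex τ r i t → S) :
    KoszulIndex r i → MvPolynomial τ S :=
  fun p => ∑ m, monomial m.1 (v (p, m))

theorem toStrand_ofStrand [Finite τ] {r i t : ℕ} (v : StrandIndex τ r i t → S) :
    toStrand (ofStrand v) = v := by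
  classical
  ext ⟨p, m⟩
  simp only [toStrand, ofStrand, coeff_sum, coeff_monomial]
  rw [Finset.sum_eq_single m]
  · simp
  · intro b _ hb
    rw [if_neg (fun h => hb (Subtype.ext h))]
  · simp

variable {f : ℕ → MvPolynomial τ S} (hf : ∀ j, (f j).IsHomogeneous 1)
include hf

theorem koszulMatrix_isHomogeneous (r i : ℕ) (p : KoszulIndex r i) (q : KoszulIndex r (i + 1)) :
    (koszulMatrix f r i p q).IsHomogeneous 1 :=
  koszulMatrix_mem f (homogeneousSubmodule τ S 1).toAddSubgroup hf r i p q

theorem toStrand_koszulMatrix_mulVec [Finite τ] {r i t : ℕ}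
    (w : KoszulIndex r (i + 1) → MvPolynomial τ S) :
    toStrand (t := t) ((koszulMatrix f r i).mulVec w) =
      (strandMatrix f r i t).mulVec (toStrand w) := by
  ext ⟨p, m⟩
  simp only [toStrand, Matrix.mulVec, dotProduct, coeff_sum, Fintype.sum_prod_type, strandMatrix]
  exact Finset.sum_congr rfl fun q _ =>
    coeff_linear_mul (koszulMatrix_isHomogeneous hf r i p q) m.2 (w q)

/-- The lift is homogeneous, so its image has no coefficients outside the strand; those inside
vanish by hypothesis. -/
theorem koszulMatrix_mulVec_ofStrand_eq_zero [Finite τ] {r i t : ℕ}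
    {v : StrandIndex τ r (i + 1) t → S} (h : (strandMatrix f r i t).mulVec v = 0) :
    (koszulMatrix f r i).mulVec (ofStrand v) = 0 := by
  ext p m
  by_cases hm : i + m.degree = t
  · have := congrFun (toStrand_koszulMatrix_mulVec hf (t := t) (ofStrand v)) (p, ⟨m, hm⟩)
    rw [toStrand_ofStrand, h] at this
    exact this
  · simp only [Matrix.mulVec, dotProduct, coeff_sum, ofStrand, Finset.mul_sum]
    refine Finset.sum_eq_zero fun q _ => Finset.sum_eq_zero fun m' _ => ?_
    exact coeff_mul_monomial_eq_zero (koszulMatrix_isHomogeneous hf r i p q)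
      (by have := m'.2; omega) _

/-- The strand is a graded piece of the Koszul complex: lift a cycle, bound it there, and project
the bounding chain back. -/
theorem strandMatrix_exact [Finite τ] {r : ℕ} (t i : ℕ)
    (h : Function.Exact (koszulMatrix f r (i + 1)).mulVec (koszulMatrix f r i).mulVec) :
    Function.Exact (strandMatrix f r (i + 1) t).mulVec (strandMatrix f r i t).mulVec := by
  intro v
  constructor
  · intro hv
    obtain ⟨w, hw⟩ := (h _).1 (koszulMatrix_mulVec_ofStrand_eq_zero hf hv)
    exact ⟨toStrand w, by rw [← toStrand_koszulMatrix_mulVec hf, hw, toStrand_ofStrand]⟩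
  · rintro ⟨w, rfl⟩
    rw [← toStrand_ofStrand w, ← toStrand_koszulMatrix_mulVec hf,
      ← toStrand_koszulMatrix_mulVec hf, (h _).2 ⟨_, rfl⟩]
    rfl

theorem mem_range_strandMatrix_zero [Finite τ] {r t : ℕ} (v : StrandIndex τ r 0 t → S) :
    (∃ w, (strandMatrix f r 0 t).mulVec w = v) ↔
      ofStrand v default ∈ Ideal.span (f '' Set.Iio r) := by
  rw [← mem_range_koszulMatrix_zero]
  constructor
  · rintro ⟨w, rfl⟩
    refine ⟨ofStrand w, ?_⟩
    ext p m
    by_cases hm : 0 + m.degree = t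
    · have h1 := congrFun (toStrand_koszulMatrix_mulVec hf (t := t) (ofStrand w)) (p, ⟨m, hm⟩)
      have h2 := congrFun (toStrand_ofStrand ((strandMatrix f r 0 t).mulVec w)) (p, ⟨m, hm⟩)
      rw [toStrand_ofStrand] at h1
      exact h1.trans h2.symm
    · classical
      have h2 : coeff m (ofStrand ((strandMatrix f r 0 t).mulVec w) p) = 0 := by
        simp only [ofStrand, coeff_sum]
        refine Finset.sum_eq_zero fun m' _ => ?_
        rw [coeff_monomial, if_neg]
        rintro rfl
        exact hm m'.2
      rw [h2]
      simp only [Matrix.mulVec, dotProduct, coeff_sum, ofStrand, Finset.mul_sum]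
      refine Finset.sum_eq_zero fun q _ => Finset.sum_eq_zero fun m' _ => ?_
      exact coeff_mul_monomial_eq_zero (koszulMatrix_isHomogeneous hf r 0 p q)
        (by have := m'.2; omega) _
  · rintro ⟨w, hw⟩
    exact ⟨toStrand w, by rw [← toStrand_koszulMatrix_mulVec hf, hw, toStrand_ofStrand]⟩

end Strand

theorem card_strandIndex (τ : Type*) [Fintype τ] (r i t : ℕ) :
    Fintype.card (StrandIndex τ r i t) =
      if i ≤ t then r.choose i * (Fintype.card τ + (t - i) - 1).choose (t - i) else 0 := by
  classical
  split_ifs with h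
  · rw [Fintype.card_prod, KoszulIndex.card_eq_choose]
    congr 1
    rw [← Finset.card_univ (α := τ), ← Finset.card_finsuppAntidiag_nat_eq_choose,
      ← Fintype.card_coe]
    refine Fintype.card_congr (Equiv.subtypeEquivRight fun m => ?_)
    rw [Finset.mem_finsuppAntidiag, ← Finsupp.degree_eq_sum]
    simp
    omega
  · rw [Fintype.card_eq_zero_iff]
    exact ⟨fun p => by have := p.2.2; omega⟩

/-- `π` factors through `φ`, because it agrees on basis vectors with the same image. This is why the
kernel of a monomial map is spanned by differences of monomials. -/
theorem Module.Basis.map_eq_zero_of_map_eq_zero {k ι ι' M M' Q : Type*} [CommRing k]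
    [AddCommGroup M] [Module k M] [AddCommGroup M'] [Module k M'] [AddCommGroup Q] [Module k Q]
    (b : Module.Basis ι k M) (b' : Module.Basis ι' k M') (φ : M →ₗ[k] M') (π : M →ₗ[k] Q)
    (G : ι → ι') (hG : ∀ i, φ (b i) = b' (G i)) (hπ : ∀ i j, G i = G j → π (b i) = π (b j))
    {m : M} (hm : φ m = 0) : π m = 0 := by
  classical
  let ψ : M' →ₗ[k] Q :=
    b'.constr k (fun i' => if h : ∃ i, G i = i' then π (b h.choose) else 0)
  have h : ψ ∘ₗ φ = π := by
    refine b.ext fun i => ?_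
    have hi : ∃ j, G j = G i := ⟨i, rfl⟩
    rw [LinearMap.comp_apply, hG, Module.Basis.constr_basis, dif_pos hi]
    exact hπ _ _ hi.choose_spec
  rw [← h, LinearMap.comp_apply, hm, map_zero]

theorem mul_pow_min_mul {M : Type*} [CommMonoid M] (a b : M) (m n : ℕ) :
    (a * b) ^ min m n * (a ^ (m - n) * b ^ (n - m)) = a ^ m * b ^ n := by
  rw [mul_pow, mul_mul_mul_comm, ← pow_add, ← pow_add]
  congr 2 <;> omega

/-! ### Rees-type algebras of inverses of variables, and primality of the relation ideals. -/

section Rees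

open MvPolynomial

variable {σ k : Type*} [Fintype σ] [DecidableEq σ] [Field k]

variable (k) in
/-- The relation `x_o T_o - x_j T_j` of the inverses of the variables, in `k[x][T]`. -/
noncomputable def inverseRel (o j : σ) : MvPolynomial σ (MvPolynomial σ k) :=
  C (X o) * X o - C (X j) * X j

/-- The exponent of `∏ x_l`, over all `l ∈ A` other than `j`. -/
noncomputable def eraseExponent (A : Finset σ) (j : σ) : σ →₀ ℕ :=
  if j ∈ A then ∑ l ∈ A.erase j, Finsupp.single l 1 else 0

variable (k) in
/-- The `k[x]`-algebra map with `T_j ↦ (∏ x_l) T_o`, over all `l ∈ A` other than `j`, if `j ∈ A`,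
and `T_j ↦ T_j` otherwise. -/
noncomputable def partialReesMap (A : Finset σ) (o : σ) :
    MvPolynomial σ (MvPolynomial σ k) →ₐ[MvPolynomial σ k] MvPolynomial σ (MvPolynomial σ k) :=
  aeval fun j => monomial (Finsupp.single (if j ∈ A then o else j) 1)
    (monomial (eraseExponent A j) 1)

omit [Fintype σ] in
theorem eraseExponent_apply {A : Finset σ} (j l : σ) :
    eraseExponent A j l = if j ∈ A ∧ l ∈ A ∧ l ≠ j then 1 else 0 := by
  unfold eraseExponent
  split_ifs with h1 h2 h2
  · simp [Finsupp.finsetSum_apply, Finsupp.single_apply, h2]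
  · simp only [Finsupp.finsetSum_apply, Finsupp.single_apply, Finset.sum_ite_eq', Finset.mem_erase]
    rw [if_neg]
    tauto
  · tauto
  · rfl

omit [Fintype σ] in
theorem partialReesMap_monomial (A : Finset σ) (o : σ) (β : σ →₀ ℕ) :
    partialReesMap k A o (monomial β 1) =
      monomial (Finsupp.linearCombination ℕ (fun j => Finsupp.single (if j ∈ A then o else j) 1) β)
        (monomial (Finsupp.linearCombination ℕ (eraseExponent A) β) 1) := by
  induction β using Finsupp.induction_linear with
  | zero => simp
  | add β γ hβ hγ =>
    rw [← mul_one (1 : MvPolynomial σ k), ← monomial_mul, map_mul, hβ, hγ, monomial_mul,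
      monomial_mul, map_add, map_add, mul_one]
  | single j n =>
    rw [← X_pow_eq_monomial, map_pow, partialReesMap, aeval_X, monomial_pow, monomial_pow]
    simp

/-- The `k`-basis of `k[x][T]` made of the monomials. -/
noncomputable abbrev iteratedBasisMonomials (σ k : Type*) [Field k] :
    Module.Basis ((σ →₀ ℕ) × (σ →₀ ℕ)) k (MvPolynomial σ (MvPolynomial σ k)) :=
  (basisMonomials σ k).smulTower (basisMonomials σ (MvPolynomial σ k))

omit [Fintype σ] [DecidableEq σ] in
theorem iteratedBasisMonomials_apply (p : (σ →₀ ℕ) × (σ →₀ ℕ)) :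
    iteratedBasisMonomials σ k p = C (monomial p.1 1) * monomial p.2 1 := by
  simp [Module.Basis.smulTower_apply, smul_eq_C_mul]

/-- The exponents of the image of a monomial under `partialReesMap`. -/
noncomputable def partialReesExponent (A : Finset σ) (o : σ) (p : (σ →₀ ℕ) × (σ →₀ ℕ)) :
    (σ →₀ ℕ) × (σ →₀ ℕ) :=
  (p.1 + Finsupp.linearCombination ℕ (eraseExponent A) p.2,
    Finsupp.linearCombination ℕ (fun j => Finsupp.single (if j ∈ A then o else j) 1) p.2)

omit [Fintype σ] in
theorem partialReesMap_iteratedBasisMonomials (A : Finset σ) (o : σ) (p : (σ →₀ ℕ) × (σ →₀ ℕ)) :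
    partialReesMap k A o (iteratedBasisMonomials σ k p) =
      iteratedBasisMonomials σ k (partialReesExponent A o p) := by
  rw [iteratedBasisMonomials_apply, iteratedBasisMonomials_apply, map_mul, partialReesMap_monomial,
    ← algebraMap_eq, AlgHom.commutes, algebraMap_eq, C_mul_monomial, C_mul_monomial, monomial_mul]
  simp [partialReesExponent]

variable (k) in
/-- The ideal of the relations among the inverses of the variables `x_j`, `j ∈ A`. -/
noncomputable def inverseRelIdeal (A : Finset σ) (o : σ) :
    Ideal (MvPolynomial σ (MvPolynomial σ k)) :=
  Ideal.span (inverseRel k o '' A)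

/-- A normal form of a monomial modulo `inverseRelIdeal`. -/
noncomputable def inverseNormalForm (k : Type*) [Field k] (A : Finset σ) (o : σ)
    (p : (σ →₀ ℕ) × (σ →₀ ℕ)) : MvPolynomial σ (MvPolynomial σ k) :=
  -- Each factor x_l T_l with l in A is traded for x_o T_o; what remains at l is a power of x_l
  -- alone or of T_l alone.
  (C (X o) * X o) ^ (∑ l ∈ A, min (p.1 l) (p.2 l)) *
    (∏ l ∈ A, C (X l) ^ (p.1 l - p.2 l) * X l ^ (p.2 l - p.1 l)) *
    ∏ l ∈ Aᶜ, C (X l) ^ p.1 l * X l ^ p.2 l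

theorem mk_iteratedBasisMonomials (A : Finset σ) (o : σ) (p : (σ →₀ ℕ) × (σ →₀ ℕ)) :
    Ideal.Quotient.mk (inverseRelIdeal k A o) (iteratedBasisMonomials σ k p) =
      Ideal.Quotient.mk (inverseRelIdeal k A o) (inverseNormalForm k A o p) := by
  have h : iteratedBasisMonomials σ k p = (∏ l ∈ A, C (X l) ^ p.1 l * X l ^ p.2 l) *
      ∏ l ∈ Aᶜ, C (X l) ^ p.1 l * X l ^ p.2 l := by
    rw [Finset.prod_mul_prod_compl, iteratedBasisMonomials_apply, monomial_eq, monomial_eq,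
      Finsupp.prod_fintype _ _ (by simp), Finsupp.prod_fintype _ _ (by simp),
      Finset.prod_mul_distrib]
    simp
  have hrel : ∀ l ∈ A, Ideal.Quotient.mk (inverseRelIdeal k A o) (C (X l) ^ p.1 l * X l ^ p.2 l) =
      Ideal.Quotient.mk (inverseRelIdeal k A o) (C (X o) * X o) ^ min (p.1 l) (p.2 l) *
        Ideal.Quotient.mk (inverseRelIdeal k A o)
          (C (X l) ^ (p.1 l - p.2 l) * X l ^ (p.2 l - p.1 l)) := by
    intro l hl
    have : Ideal.Quotient.mk (inverseRelIdeal k A o) (C (X o) * X o) =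
        Ideal.Quotient.mk (inverseRelIdeal k A o) (C (X l) * X l) :=
      Ideal.Quotient.eq.2 (Ideal.subset_span ⟨l, hl, rfl⟩)
    rw [this, ← map_pow (Ideal.Quotient.mk _), ← map_mul (Ideal.Quotient.mk _), mul_pow_min_mul]
  rw [h, inverseNormalForm, map_mul, map_mul, map_mul, map_prod _ _ A, map_prod _ _ A, map_pow,
    Finset.prod_congr rfl hrel, Finset.prod_mul_distrib, Finset.prod_pow_eq_pow_sum]

/-- Every T_j with j in A contributes one factor x_l, except T_l itself; `p.2 l` is moved to the
left to avoid subtraction. -/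
theorem partialReesExponent_fst_apply_add {A : Finset σ} (o : σ) (p : (σ →₀ ℕ) × (σ →₀ ℕ)) {l : σ}
    (hl : l ∈ A) : (partialReesExponent A o p).1 l + p.2 l = p.1 l + ∑ j ∈ A, p.2 j := by
  rw [partialReesExponent, Finsupp.add_apply, add_assoc]
  congr 1
  rw [Finsupp.linearCombination_apply, Finsupp.sum_fintype _ _ (by simp), Finsupp.finsetSum_apply,
    ← Finset.add_sum_erase _ _ hl, add_comm, ← Finset.sum_filter_add_sum_filter_not Finset.univ
      (· ∈ A.erase l)]
  congr 1
  rw [Finset.filter_mem_eq_inter, Finset.univ_inter]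
  rw [Finset.sum_eq_zero (s := Finset.univ.filter _), add_zero]
  · refine Finset.sum_congr rfl fun j hj => ?_
    rw [Finset.mem_erase] at hj
    rw [Finsupp.smul_apply, eraseExponent_apply, if_pos ⟨hj.2, hl, hj.1.symm⟩]
    simp
  · intro j hj
    rw [Finset.mem_filter, Finset.mem_erase] at hj
    rw [Finsupp.smul_apply, eraseExponent_apply, if_neg (fun h => hj.2 ⟨h.2.2.symm, h.1⟩)]
    simp

theorem partialReesExponent_fst_apply {A : Finset σ} (o : σ) (p : (σ →₀ ℕ) × (σ →₀ ℕ)) {l : σ}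
    (hl : l ∉ A) : (partialReesExponent A o p).1 l = p.1 l := by
  rw [partialReesExponent, Finsupp.add_apply, Finsupp.linearCombination_apply,
    Finsupp.sum_fintype _ _ (by simp), Finsupp.finsetSum_apply, Finset.sum_eq_zero, add_zero]
  intro j _
  rw [Finsupp.smul_apply, eraseExponent_apply, if_neg (by tauto)]
  simp

theorem partialReesExponent_snd_apply_self {A : Finset σ} {o : σ} (ho : o ∈ A)
    (p : (σ →₀ ℕ) × (σ →₀ ℕ)) : (partialReesExponent A o p).2 o = ∑ j ∈ A, p.2 j := by
  simp only [partialReesExponent]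
  rw [Finsupp.linearCombination_apply,
    Finsupp.sum_fintype _ _ (by simp), Finsupp.finsetSum_apply]
  refine Eq.trans (Finset.sum_congr rfl fun j _ => ?_)
    ((Finset.sum_ite_mem Finset.univ A p.2).trans (by rw [Finset.univ_inter]))
  split_ifs with h
  · simp
  · rw [Finsupp.smul_apply, Finsupp.single_eq_of_ne (by rintro rfl; exact h ho), smul_zero]

theorem partialReesExponent_snd_apply {A : Finset σ} {o : σ} (ho : o ∈ A)
    (p : (σ →₀ ℕ) × (σ →₀ ℕ)) {l : σ} (hl : l ∉ A) : (partialReesExponent A o p).2 l = p.2 l := by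
  simp only [partialReesExponent]
  rw [Finsupp.linearCombination_apply,
    Finsupp.sum_fintype _ _ (by simp), Finsupp.finsetSum_apply, Finset.sum_eq_single l]
  · simp [hl]
  · intro j _ hj
    rw [Finsupp.smul_apply, Finsupp.single_eq_of_ne, smul_zero]
    split_ifs with h
    · rintro rfl; exact hl ho
    · exact hj.symm
  · simp

/-- The image monomial records the total T-degree over A (as the exponent of T_o) and the
differences of the x_l- and T_l-exponents for l in A. These also fix the number of traded pairs,
since min(a, b) = b - (b - a) with truncated subtraction. -/
theorem inverseNormalForm_congr {A : Finset σ} {o : σ} (ho : o ∈ A) {p q : (σ →₀ ℕ) × (σ →₀ ℕ)}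
    (h : partialReesExponent A o p = partialReesExponent A o q) :
    inverseNormalForm k A o p = inverseNormalForm k A o q := by
  have hB : ∑ j ∈ A, p.2 j = ∑ j ∈ A, q.2 j := by
    rw [← partialReesExponent_snd_apply_self ho, h, partialReesExponent_snd_apply_self ho]
  have hA : ∀ l ∈ A, p.1 l + q.2 l = q.1 l + p.2 l := by
    intro l hl
    have h1 := partialReesExponent_fst_apply_add o p hl
    have h2 := partialReesExponent_fst_apply_add o q hl
    rw [h] at h1
    omega
  have hM : ∑ l ∈ A, min (p.1 l) (p.2 l) = ∑ l ∈ A, min (q.1 l) (q.2 l) := by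
    have h1 : ∑ l ∈ A, min (p.1 l) (p.2 l) + ∑ l ∈ A, (p.2 l - p.1 l) = ∑ j ∈ A, p.2 j := by
      rw [← Finset.sum_add_distrib]
      exact Finset.sum_congr rfl fun l _ => by omega
    have h2 : ∑ l ∈ A, min (q.1 l) (q.2 l) + ∑ l ∈ A, (p.2 l - p.1 l) = ∑ j ∈ A, q.2 j := by
      rw [← Finset.sum_add_distrib]
      exact Finset.sum_congr rfl fun l hl => by have := hA l hl; omega
    omega
  unfold inverseNormalForm
  rw [hM]
  congr 1
  · congr 1
    refine Finset.prod_congr rfl fun l hl => ?_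
    have := hA l hl
    rw [(by omega : p.1 l - p.2 l = q.1 l - q.2 l), (by omega : p.2 l - p.1 l = q.2 l - q.1 l)]
  · refine Finset.prod_congr rfl fun l hl => ?_
    rw [Finset.mem_compl] at hl
    rw [← partialReesExponent_fst_apply o p hl, h, partialReesExponent_fst_apply o q hl,
      ← partialReesExponent_snd_apply ho p hl, h, partialReesExponent_snd_apply ho q hl]

omit [Fintype σ] in
theorem partialReesMap_inverseRel {A : Finset σ} {o : σ} (ho : o ∈ A) {j : σ} (hj : j ∈ A) :
    partialReesMap k A o (inverseRel k o j) = 0 := by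
  have key : ∀ i ∈ A, partialReesMap k A o (C (X i) * X i) =
      monomial (Finsupp.single o 1) (monomial (∑ l ∈ A, Finsupp.single l 1) 1) := by
    intro i hi
    rw [map_mul, ← algebraMap_eq, AlgHom.commutes, algebraMap_eq, partialReesMap, aeval_X,
      C_mul_monomial, X, monomial_mul, if_pos hi, eraseExponent, if_pos hi,
      Finset.add_sum_erase A (fun l => Finsupp.single l 1) hi, mul_one]
  rw [inverseRel, map_sub, key o ho, key j hj, sub_self]

/-- The relations `x_o T_o = x_j T_j` define the ring generated over `k[x]` by the inverses of the
variables `x_j`, `j ∈ A`. -/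
theorem partialReesMap_eq_zero_iff {A : Finset σ} {o : σ} (ho : o ∈ A)
    (g : MvPolynomial σ (MvPolynomial σ k)) :
    partialReesMap k A o g = 0 ↔ g ∈ inverseRelIdeal k A o := by
  constructor
  · intro h
    rw [← Ideal.Quotient.eq_zero_iff_mem]
    refine (iteratedBasisMonomials σ k).map_eq_zero_of_map_eq_zero (iteratedBasisMonomials σ k)
      ((partialReesMap k A o).toLinearMap.restrictScalars k)
      ((Ideal.Quotient.mkₐ k (inverseRelIdeal k A o)).toLinearMap) (partialReesExponent A o)
      (partialReesMap_iteratedBasisMonomials A o) ?_ h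
    intro p q hpq
    refine (mk_iteratedBasisMonomials A o p).trans ?_
    rw [inverseNormalForm_congr ho hpq]
    exact (mk_iteratedBasisMonomials A o q).symm
  · intro h
    have : inverseRelIdeal k A o ≤ RingHom.ker (partialReesMap k A o) := by
      refine Ideal.span_le.2 ?_
      rintro _ ⟨j, hj, rfl⟩
      exact partialReesMap_inverseRel ho hj
    exact this h

/-- The ideal is the kernel of a map into a domain, and the image of the new relation is nonzero:
its T_j-coefficient is -x_j. -/
theorem mem_inverseRelIdeal_of_mul_mem {A : Finset σ} {o : σ} (ho : o ∈ A) {j : σ} (hj : j ∉ A)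
    {g : MvPolynomial σ (MvPolynomial σ k)}
    (h : inverseRel k o j * g ∈ inverseRelIdeal k A o) : g ∈ inverseRelIdeal k A o := by
  rw [← partialReesMap_eq_zero_iff ho] at h ⊢
  rw [map_mul, mul_eq_zero] at h
  refine h.resolve_left fun h0 => ?_
  have h1 := congrArg (coeff (Finsupp.single j 1)) h0
  rw [inverseRel, map_sub, map_mul, map_mul, ← algebraMap_eq, AlgHom.commutes, AlgHom.commutes,
    algebraMap_eq, partialReesMap, aeval_X, aeval_X, if_pos ho, if_neg hj, coeff_sub, coeff_C_mul,
    coeff_C_mul, coeff_monomial, coeff_monomial, if_pos rfl, if_neg, eraseExponent, if_neg hj]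
    at h1
  · simp at h1
  · rw [Finsupp.single_left_inj one_ne_zero]
    rintro rfl
    exact hj ho

end Rees

theorem Function.Exact.mulVec_submatrix {R l m n l' m' n' : Type*} [CommRing R] [Fintype m]
    [Fintype n] [Fintype m'] [Fintype n'] {A : Matrix m n R} {B : Matrix l m R}
    (h : Function.Exact A.mulVec B.mulVec) (e₁ : l' ≃ l) (e₂ : m' ≃ m) (e₃ : n' ≃ n) :
    Function.Exact (A.submatrix e₂ e₃).mulVecLin (B.submatrix e₁ e₂).mulVecLin := by
  intro v
  simp only [Matrix.mulVecLin_apply, Set.mem_range, Matrix.submatrix_mulVec_equiv]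
  have h1 : B.mulVec (v ∘ e₂.symm) ∘ e₁ = 0 ↔ B.mulVec (v ∘ e₂.symm) = 0 := by
    constructor
    · intro h0
      funext i
      simpa using congrFun h0 (e₁.symm i)
    · intro h0
      rw [h0]
      rfl
  rw [h1, h]
  constructor
  · rintro ⟨w, hw⟩
    refine ⟨w ∘ e₃, ?_⟩
    rw [Function.comp_assoc, e₃.self_comp_symm, Function.comp_id, hw, Function.comp_assoc,
      e₂.symm_comp_self, Function.comp_id]
  · rintro ⟨w, rfl⟩
    exact ⟨w ∘ e₃.symm, by rw [Function.comp_assoc, e₂.self_comp_symm, Function.comp_id]⟩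

/-! ### The linear resolution of the powers of the path ideal. -/

section CyclePath

open MvPolynomial

variable {k : Type*} [Field k] {N : ℕ}

variable (k N) in
/-- The relations `x_0 T_0 - x_{j+1} T_{j+1}`. -/
noncomputable def inverseRelSeq (j : ℕ) :
    MvPolynomial (Fin (N + 1)) (MvPolynomial (Fin (N + 1)) k) :=
  -- `Fin.ofNat` wraps around modulo N + 1, but the Koszul complex only involves j < N, where it
  -- does not.
  inverseRel k 0 (Fin.ofNat (N + 1) (j + 1))

theorem inverseRelSeq_isHomogeneous (j : ℕ) : (inverseRelSeq k N j).IsHomogeneous 1 := by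
  have h (i : Fin (N + 1)) : (C (X i) * X i : MvPolynomial (Fin (N + 1))
      (MvPolynomial (Fin (N + 1)) k)).IsHomogeneous 1 := by
    simpa using (isHomogeneous_C (Fin (N + 1)) (X i : MvPolynomial (Fin (N + 1)) k)).mul
      (isHomogeneous_X _ i)
  exact (h 0).sub (h _)

theorem coeff_inverseRel_isHomogeneous {σ : Type*} (o j : σ) (m : σ →₀ ℕ) :
    (coeff m (inverseRel k o j)).IsHomogeneous 1 := by
  classical
  have h (i : σ) : (coeff m (C (X i) * X i : MvPolynomial σ (MvPolynomial σ k))).IsHomogeneous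
      1 := by
    rw [coeff_C_mul, coeff_X]
    split_ifs
    · rw [mul_one]
      exact isHomogeneous_X _ _
    · rw [mul_zero]
      exact isHomogeneous_zero _ _ _
  rw [inverseRel, coeff_sub]
  exact (h o).sub (h j)

/-- The polynomials with homogeneous linear coefficients. -/
def linearCoeffs (τ σ k : Type*) [CommRing k] : AddSubgroup (MvPolynomial τ (MvPolynomial σ k)) where
  carrier := {p | ∀ m, (coeff m p).IsHomogeneous 1}
  zero_mem' m := by
    rw [coeff_zero]
    exact isHomogeneous_zero _ _ _
  add_mem' hp hq m := by
    rw [coeff_add]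
    exact (hp m).add (hq m)
  neg_mem' {p} hp m := by
    rw [coeff_neg]
    exact (hp m).neg

theorem strandMatrix_isHomogeneous (r i t : ℕ) (p : StrandIndex (Fin (N + 1)) r i t)
    (q : StrandIndex (Fin (N + 1)) r (i + 1) t) :
    (strandMatrix (inverseRelSeq k N) r i t p q).IsHomogeneous 1 := by
  have h := koszulMatrix_mem (inverseRelSeq k N) (linearCoeffs _ _ k)
    (fun j => coeff_inverseRel_isHomogeneous _ _) r i p.1 q.1
  rw [strandMatrix, coeff_mul_monomial']
  split_ifs
  · rw [mul_one]
    exact h _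
  · exact isHomogeneous_zero _ _ _

theorem span_inverseRelSeq {r : ℕ} (hr : r ≤ N) :
    Ideal.span (inverseRelSeq k N '' Set.Iio r) =
      inverseRelIdeal k (Finset.univ.filter fun l : Fin (N + 1) => l.val ≤ r) 0 := by
  refine le_antisymm (Ideal.span_le.2 ?_) (Ideal.span_le.2 ?_)
  · rintro _ ⟨j, hj, rfl⟩
    have hj : j < r := hj
    refine Ideal.subset_span ⟨_, ?_, rfl⟩
    simp only [Finset.coe_filter, Finset.mem_univ, true_and, Set.mem_ofPred_eq, Fin.val_ofNat]
    rw [Nat.mod_eq_of_lt (by omega)]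
    omega
  · rintro _ ⟨j, hj, rfl⟩
    simp only [Finset.coe_filter, Finset.mem_univ, true_and, Set.mem_ofPred_eq] at hj
    induction j using Fin.cases with
    -- The index 0 belongs to A but only gives the trivial relation x_0 T_0 - x_0 T_0.
    | zero =>
      rw [inverseRel, sub_self]
      exact Ideal.zero_mem _
    | succ j =>
      refine Ideal.subset_span ⟨j, ?_, ?_⟩
      · exact hj
      · rw [inverseRelSeq]
        congr 1
        ext
        rw [Fin.val_ofNat, Nat.mod_eq_of_lt (by omega), Fin.val_succ]

theorem koszulMatrix_inverseRelSeq_exact (i : ℕ) :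
    Function.Exact (koszulMatrix (inverseRelSeq k N) N (i + 1)).mulVec
      (koszulMatrix (inverseRelSeq k N) N i).mulVec := by
  refine koszulMatrix_exact _ N (fun j hj g hg => ?_) i
  rw [span_inverseRelSeq hj.le] at hg ⊢
  refine mem_inverseRelIdeal_of_mul_mem (by simp) ?_ hg
  simp only [Finset.mem_filter, Finset.mem_univ, true_and, Fin.val_ofNat]
  rw [Nat.mod_eq_of_lt (by omega)]
  omega

variable (k) in
/-- The product of all variables but one. -/
noncomputable def coVariable {σ : Type*} [Fintype σ] [DecidableEq σ] (j : σ) : MvPolynomial σ k :=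
  ∏ l ∈ Finset.univ.erase j, X l

theorem coVariable_isHomogeneous (j : Fin (N + 1)) : (coVariable k j).IsHomogeneous N := by
  have h := IsHomogeneous.prod (Finset.univ.erase j) (fun l => (X l : MvPolynomial (Fin (N + 1)) k))
    (fun _ => 1) fun l _ => isHomogeneous_X _ _
  rw [coVariable]
  simpa using h

/-- With A everything, T_j goes to `coVariable k j` times T_o. On forms of degree t the map is
therefore evaluation at the generators of J, with T_o^t recording the degree. -/
theorem partialReesMap_univ {σ : Type*} [Fintype σ] [DecidableEq σ] (o : σ) {t : ℕ}
    {w : MvPolynomial σ (MvPolynomial σ k)} (hw : w.IsHomogeneous t) :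
    partialReesMap k Finset.univ o w = C (eval (coVariable k) w) * X o ^ t := by
  have hc (j : σ) : monomial (Finsupp.single (if j ∈ Finset.univ then o else j) 1)
      (monomial (eraseExponent Finset.univ j) 1) =
        (C (coVariable k j) * X o : MvPolynomial σ (MvPolynomial σ k)) := by
    rw [if_pos (Finset.mem_univ j), eraseExponent, if_pos (Finset.mem_univ j), coVariable, X,
      C_mul_monomial, mul_one, monomial_sum_one]
    rfl
  simp only [partialReesMap, hc]
  rw [aeval_def, eval₂_eq, eval_eq, map_sum, Finset.sum_mul]
  refine Finset.sum_congr rfl fun d hd => ?_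
  have hdeg : ∑ i ∈ d.support, d i = t := by
    rw [← Finsupp.degree_apply]
    by_contra h
    exact mem_support_iff.1 hd (hw.coeff_eq_zero h)
  simp only [mul_pow, Finset.prod_mul_distrib]
  rw [Finset.prod_pow_eq_pow_sum, hdeg, map_mul, map_prod, algebraMap_eq, mul_assoc]
  simp only [map_pow]

variable (k N) in
/-- The generators of the `t`-th power of the ideal generated by all `coVariable`s. -/
noncomputable def coVariableGenerator (t : ℕ) (p : StrandIndex (Fin (N + 1)) N 0 t) :
    MvPolynomial (Fin (N + 1)) k :=
  eval (coVariable k) (monomial p.2.1 1)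

theorem coVariableGenerator_isHomogeneous (t : ℕ) (p : StrandIndex (Fin (N + 1)) N 0 t) :
    (coVariableGenerator k N t p).IsHomogeneous (N * t) := by
  rw [coVariableGenerator, eval_monomial, one_mul, Finsupp.prod]
  have h := IsHomogeneous.prod p.2.1.support (fun j => coVariable k j ^ p.2.1 j)
    (fun j => N * p.2.1 j) fun j _ => (coVariable_isHomogeneous j).pow _
  rwa [← Finset.mul_sum, ← Finsupp.degree_apply, (by have := p.2.2; omega : p.2.1.degree = t)] at h

theorem linearCombination_coVariableGenerator (t : ℕ)
    (v : StrandIndex (Fin (N + 1)) N 0 t → MvPolynomial (Fin (N + 1)) k) :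
    Fintype.linearCombination _ (coVariableGenerator k N t) v =
      eval (coVariable k) (ofStrand v default) := by
  rw [Fintype.linearCombination_apply, Fintype.sum_prod_type, Fintype.sum_unique, ofStrand, map_sum]
  refine Finset.sum_congr rfl fun m _ => ?_
  rw [coVariableGenerator, eval_monomial, eval_monomial, one_mul, smul_eq_mul]

theorem ofStrand_isHomogeneous {t : ℕ}
    (v : StrandIndex (Fin (N + 1)) N 0 t → MvPolynomial (Fin (N + 1)) k) :
    (ofStrand v default).IsHomogeneous t :=
  IsHomogeneous.sum _ _ _ fun m _ => isHomogeneous_monomial _ (by have := m.2; omega)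

/-- Both conditions say that the degree t form with coefficients `v` lies in the kernel of the full
Rees map. -/
theorem strandMatrix_exact_linearCombination (t : ℕ) :
    Function.Exact (strandMatrix (inverseRelSeq k N) N 0 t).mulVec
      (Fintype.linearCombination (MvPolynomial (Fin (N + 1)) k) (coVariableGenerator k N t)) := by
  intro v
  have hA : (Finset.univ.filter fun l : Fin (N + 1) => l.val ≤ N) = Finset.univ :=
    Finset.filter_true_of_mem fun l _ => by omega
  rw [Set.mem_range, mem_range_strandMatrix_zero inverseRelSeq_isHomogeneous,
    span_inverseRelSeq le_rfl, hA, ← partialReesMap_eq_zero_iff (Finset.mem_univ _),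
    partialReesMap_univ _ (ofStrand_isHomogeneous v), linearCombination_coVariableGenerator,
    mul_eq_zero, C_eq_zero]
  exact ⟨Or.inl, fun h => h.resolve_right (pow_ne_zero _ (X_ne_zero _))⟩

theorem span_coVariableGenerator (t : ℕ) :
    Ideal.span (Set.range (coVariableGenerator k N t)) =
      Ideal.span (Set.range (coVariable k : Fin (N + 1) → _)) ^ t := by
  refine le_antisymm (Ideal.span_le.2 ?_) fun y hy => ?_
  · rintro _ ⟨p, rfl⟩
    refine (Ideal.mem_span_pow_iff_exists_isHomogeneous _ _).2
      ⟨_, isHomogeneous_monomial _ ?_, rfl⟩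
    have := p.2.2
    omega
  · obtain ⟨w, hw, rfl⟩ := (Ideal.mem_span_pow_iff_exists_isHomogeneous _ _).1 hy
    rw [eval_eq]
    refine Ideal.sum_mem _ fun d hd => Ideal.mul_mem_left _ _ (Ideal.subset_span ?_)
    have hdeg : 0 + d.degree = t := by
      rw [zero_add]
      by_contra h
      exact mem_support_iff.1 hd (hw.coeff_eq_zero h)
    refine ⟨(default, ⟨d, hdeg⟩), ?_⟩
    rw [coVariableGenerator, eval_monomial, one_mul]
    rfl

/-- The path of N vertices starting at `a` misses only the vertex just before `a`, which is `a +
Fin.last N` modulo N + 1. -/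
theorem cyclePathMonomial_eq_coVariable (a : Fin (N + 1)) :
    cyclePathMonomial k (N + 1) N a = coVariable k (a + Fin.last N) := by
  have hmod : ∀ j ≤ N, (a.val + j) % (N + 1) =
      if a.val + j < N + 1 then a.val + j else a.val + j - (N + 1) := by
    intro j hj
    split_ifs with h
    · exact Nat.mod_eq_of_lt h
    · rw [Nat.mod_eq_sub_mod (by omega), Nat.mod_eq_of_lt (by omega)]
  rw [cyclePathMonomial, coVariable]
  refine Finset.prod_bij (fun j _ => ⟨(a.val + j) % (N + 1), Nat.mod_lt _ a.pos⟩) ?_ ?_ ?_ ?_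
  · intro j hj
    rw [Finset.mem_range] at hj
    refine Finset.mem_erase.2 ⟨?_, Finset.mem_univ _⟩
    rw [Ne, Fin.ext_iff, Fin.val_add, Fin.val_last, hmod _ le_rfl]
    dsimp only
    rw [hmod _ hj.le]
    split_ifs <;> omega
  · intro j hj j' hj' h
    rw [Finset.mem_range] at hj hj'
    rw [Fin.ext_iff] at h
    simp only [hmod _ hj.le, hmod _ hj'.le] at h
    split_ifs at h <;> omega
  · intro l hl
    rw [Finset.mem_erase, Ne, Fin.ext_iff, Fin.val_add, Fin.val_last, hmod _ le_rfl] at hl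
    have hl := hl.1
    refine ⟨if a.val ≤ l.val then l - a else l + (N + 1) - a, ?_, ?_⟩
    · rw [Finset.mem_range]
      split_ifs at hl ⊢ <;> omega
    · ext
      dsimp only
      rw [hmod _ (by split_ifs <;> omega)]
      split_ifs <;> omega
  · intro j _
    rfl

theorem cyclePathIdeal_eq_span_coVariable :
    cyclePathIdeal k (N + 1) N = Ideal.span (Set.range (coVariable k : Fin (N + 1) → _)) := by
  have h : cyclePathMonomial k (N + 1) N = coVariable k ∘ Equiv.addRight (Fin.last N) :=
    funext cyclePathMonomial_eq_coVariable
  rw [cyclePathIdeal, h, (Equiv.addRight (Fin.last N)).surjective.range_comp]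

theorem exists_linear_resolution_cyclePathIdeal_pow (t : ℕ) :
    ∃ (b : ℕ → ℕ) (g : Fin (b 0) → MvPolynomial (Fin (N + 1)) k)
      (A : ∀ i : ℕ, Matrix (Fin (b i)) (Fin (b (i + 1))) (MvPolynomial (Fin (N + 1)) k)),
      (∀ i, b i = if i ≤ t then N.choose i * (N + 1 + (t - i) - 1).choose (t - i) else 0) ∧
      (∀ r, (g r).IsHomogeneous (N * t)) ∧
      (∀ i r s, (A i r s).IsHomogeneous 1) ∧
      Ideal.span (Set.range g) = cyclePathIdeal k (N + 1) N ^ t ∧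
      Function.Exact (A 0).mulVecLin
        (Fintype.linearCombination (MvPolynomial (Fin (N + 1)) k) g) ∧
      ∀ i, Function.Exact (A (i + 1)).mulVecLin (A i).mulVecLin := by
  let e (i : ℕ) := (Fintype.equivFin (StrandIndex (Fin (N + 1)) N i t)).symm
  refine ⟨fun i => Fintype.card (StrandIndex (Fin (N + 1)) N i t),
    coVariableGenerator k N t ∘ e 0,
    fun i => (strandMatrix (inverseRelSeq k N) N i t).submatrix (e i) (e (i + 1)), fun i => ?_,
    fun r => coVariableGenerator_isHomogeneous t _,
    fun i r s => strandMatrix_isHomogeneous N i t _ _, ?_, ?_, fun i => ?_⟩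
  · exact (card_strandIndex _ _ _ _).trans (by rw [Fintype.card_fin])
  · rw [(e 0).surjective.range_comp, span_coVariableGenerator, cyclePathIdeal_eq_span_coVariable]
  · intro v
    have hv : Fintype.linearCombination (MvPolynomial (Fin (N + 1)) k)
        (coVariableGenerator k N t ∘ e 0) v =
        Fintype.linearCombination _ (coVariableGenerator k N t) (v ∘ (e 0).symm) := by
      rw [Fintype.linearCombination_apply, Fintype.linearCombination_apply]
      exact Fintype.sum_equiv (e 0) _ _ fun i => by simp
    rw [hv, strandMatrix_exact_linearCombination]
    simp only [Set.mem_range, Matrix.mulVecLin_apply, Matrix.submatrix_mulVec_equiv]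
    constructor
    · rintro ⟨w, hw⟩
      refine ⟨w ∘ e 1, ?_⟩
      rw [Function.comp_assoc, (e 1).self_comp_symm, Function.comp_id, hw, Function.comp_assoc,
        (e 0).symm_comp_self, Function.comp_id]
    · rintro ⟨w, rfl⟩
      exact ⟨w ∘ (e 1).symm, by rw [Function.comp_assoc, (e 0).self_comp_symm, Function.comp_id]⟩
  · exact (strandMatrix_exact inverseRelSeq_isHomogeneous t i
      (koszulMatrix_inverseRelSeq_exact i)).mulVec_submatrix (e i) (e (i + 1)) (e (i + 2))

end CyclePath

/-! ### Tor from a resolution whose differentials vanish after tensoring. -/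

section Tor

open CategoryTheory MonoidalCategory

universe u

theorem ChainComplex.quasiIso_toSingle₀Equiv_symm {C : Type*} [Category* C] [Abelian C]
    (K : ChainComplex C ℕ) {Z : C} (ε : K.X 0 ⟶ Z) (w : K.d 1 0 ≫ ε = 0) [Epi ε]
    (h0 : (ShortComplex.mk _ _ w).Exact) (h : ∀ n, K.ExactAt (n + 1)) :
    QuasiIso ((ChainComplex.toSingle₀Equiv K Z).symm ⟨ε, w⟩) where
  quasiIsoAt n := by
    cases n with
    | zero =>
      rw [ChainComplex.quasiIsoAt₀_iff, ShortComplex.quasiIso_iff_of_zeros']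
      · refine (ShortComplex.exact_and_epi_g_iff_of_iso (S₁ := ShortComplex.mk _ _ w) ?_).1
          ⟨h0, inferInstance⟩
        exact ShortComplex.isoMk (Iso.refl _) (Iso.refl _) (Iso.refl _)
          ((Category.id_comp _).trans (Category.comp_id _).symm) ((Category.id_comp _).trans
            ((ChainComplex.toSingle₀Equiv_symm_apply_f_zero ε w).trans (Category.comp_id ε).symm))
      all_goals first | rfl | (simp; rfl)
    | succ n =>
      rw [quasiIsoAt_iff_exactAt']
      · exact h n
      · apply ChainComplex.exactAt_succ_single_obj

variable {R : Type u} [CommRing R] {M : Type u} [AddCommGroup M] [Module R M]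
  {F : ℕ → Type u} [∀ i, AddCommGroup (F i)] [∀ i, Module R (F i)]

/-- A chain complex of modules from its differentials. -/
noncomputable def ModuleCat.chainComplexOfExact (d : ∀ i, F (i + 1) →ₗ[R] F i)
    (h : ∀ i, Function.Exact (d (i + 1)) (d i)) : ChainComplex (ModuleCat.{u} R) ℕ :=
  ChainComplex.of (fun i => ModuleCat.of R (F i)) (fun i => ModuleCat.ofHom (d i))
    (fun i => by ext x; exact (h i).apply_apply_eq_zero x)

theorem ModuleCat.chainComplexOfExact_d (d : ∀ i, F (i + 1) →ₗ[R] F i)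
    (h : ∀ i, Function.Exact (d (i + 1)) (d i)) (i : ℕ) :
    (ModuleCat.chainComplexOfExact d h).d (i + 1) i = ModuleCat.ofHom (d i) :=
  ChainComplex.of_d (fun i => ModuleCat.of R (F i)) (fun i => ModuleCat.ofHom (d i)) i

/-- A projective resolution from an exact sequence of projective modules. -/
noncomputable def ModuleCat.projectiveResolutionOfExact [∀ i, Module.Projective R (F i)]
    (d : ∀ i, F (i + 1) →ₗ[R] F i) (ε : F 0 →ₗ[R] M) (hε : Function.Surjective ε)
    (h0 : Function.Exact (d 0) ε) (h : ∀ i, Function.Exact (d (i + 1)) (d i)) :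
    ProjectiveResolution (ModuleCat.of R M) :=
  have hd : (ModuleCat.chainComplexOfExact d h).d 1 0 ≫ ModuleCat.ofHom ε = 0 := by
    rw [chainComplexOfExact_d]; ext x; exact h0.apply_apply_eq_zero x
  have : Epi (X := (chainComplexOfExact d h).X 0) (Y := ModuleCat.of R M) (ModuleCat.ofHom ε) :=
    (ModuleCat.epi_iff_surjective _).2 hε
  { complex := ModuleCat.chainComplexOfExact d h
    projective := fun i => (IsProjective.iff_projective (F i)).1 inferInstance
    π := (ChainComplex.toSingle₀Equiv _ _).symm ⟨ModuleCat.ofHom ε, hd⟩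
    quasiIso := ChainComplex.quasiIso_toSingle₀Equiv_symm _ _ hd
      (ModuleCat.shortComplex_exact _ (by
        change Function.Exact ((chainComplexOfExact d h).d 1 0).hom ε
        rw [chainComplexOfExact_d]
        exact h0))
      (fun n => by
        rw [HomologicalComplex.exactAt_iff' _ (n + 1 + 1) (n + 1) n (by simp) (by simp)]
        refine ModuleCat.shortComplex_exact _ ?_
        change Function.Exact ((chainComplexOfExact d h).d (n + 2) (n + 1)).hom
          ((chainComplexOfExact d h).d (n + 1) n).hom
        rw [chainComplexOfExact_d, chainComplexOfExact_d]
        exact h n) }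

theorem ChainComplex.nonempty_homology_iso_of_d_eq_zero {C : Type*} [Category* C] [Abelian C]
    (K : ChainComplex C ℕ) (hK : ∀ i, K.d (i + 1) i = 0) (i : ℕ) :
    Nonempty (K.homology i ≅ K.X i) := by
  have h : ∀ i j, K.d i j = 0 := by
    intro i j
    by_cases hij : (ComplexShape.down ℕ).Rel i j
    · obtain rfl : j + 1 = i := hij
      exact hK j
    · exact K.shape _ _ hij
  exact ⟨(ShortComplex.LeftHomologyData.ofZeros (K.sc i) (h _ _) (h _ _)).homologyIso⟩

/-- `Tor` is derived in its second argument, so resolving `M` computes it; with zero differentials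
the homology is the complex itself. -/
theorem ModuleCat.nonempty_tor_iso_of_lTensor_eq_zero [∀ i, Module.Projective R (F i)]
    (d : ∀ i, F (i + 1) →ₗ[R] F i) (ε : F 0 →ₗ[R] M) (hε : Function.Surjective ε)
    (h0 : Function.Exact (d 0) ε) (h : ∀ i, Function.Exact (d (i + 1)) (d i))
    {Q : Type u} [AddCommGroup Q] [Module R Q] (hd : ∀ i, (d i).lTensor Q = 0) (i : ℕ) :
    Nonempty (((Tor (ModuleCat.{u} R) i).obj (ModuleCat.of R Q)).obj (ModuleCat.of R M) ≅
      ModuleCat.of R (TensorProduct R Q (F i))) := by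
  let P := ModuleCat.projectiveResolutionOfExact d ε hε h0 h
  let G := (tensoringLeft (ModuleCat.{u} R)).obj (ModuleCat.of R Q)
  obtain ⟨e⟩ := ChainComplex.nonempty_homology_iso_of_d_eq_zero
    ((G.mapHomologicalComplex (ComplexShape.down ℕ)).obj P.complex) (by
      intro j
      have : P.complex.d (j + 1) j = ModuleCat.ofHom (d j) :=
        ModuleCat.chainComplexOfExact_d d h j
      refine (congrArg G.map this).trans ?_
      refine ModuleCat.hom_ext ?_
      exact (ModuleCat.hom_whiskerLeft (ModuleCat.of R Q) (ModuleCat.ofHom (d j))).trans (hd j)) i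
  exact ⟨P.isoLeftDerivedObj G i ≪≫ e⟩

theorem Matrix.lTensor_mulVecLin_quotient_eq_zero {m n : Type*} [Fintype m] [DecidableEq m]
    [Fintype n] (A : Matrix m n R) (J : Ideal R) (hA : ∀ r s, A r s ∈ J) :
    A.mulVecLin.lTensor (R ⧸ J) = 0 := by
  refine TensorProduct.ext' fun q v => ?_
  obtain ⟨q, rfl⟩ := Ideal.Quotient.mk_surjective q
  have hv : A.mulVecLin v = ∑ r, A.mulVec v r • Pi.single r (1 : R) := by
    refine funext fun r => ?_
    simp [Finset.sum_apply, Pi.single_apply]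
  rw [LinearMap.lTensor_tmul, LinearMap.zero_apply, hv, TensorProduct.tmul_sum]
  refine Finset.sum_eq_zero fun r _ => ?_
  have hr : A.mulVec v r • (Ideal.Quotient.mk J q) = 0 :=
    Ideal.Quotient.eq_zero_iff_mem.2 (J.mul_mem_right _
      (J.sum_mem fun s _ => J.mul_mem_right _ (hA r s)))
  rw [TensorProduct.tmul_smul, TensorProduct.smul_tmul', hr, TensorProduct.zero_tmul]

theorem ModuleCat.nonempty_tor_equiv_of_matrix_resolution {I : Ideal R} (b : ℕ → ℕ)
    (g : Fin (b 0) → R) (A : ∀ i : ℕ, Matrix (Fin (b i)) (Fin (b (i + 1))) R)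
    (hg : Ideal.span (Set.range g) = I)
    (h0 : Function.Exact (A 0).mulVecLin (Fintype.linearCombination R g))
    (h : ∀ i, Function.Exact (A (i + 1)).mulVecLin (A i).mulVecLin) (J : Ideal R)
    (hA : ∀ i r s, A i r s ∈ J) (i : ℕ) :
    Nonempty (((Tor (ModuleCat.{u} R) i).obj (ModuleCat.of R (R ⧸ J))).obj (ModuleCat.of R I) ≃ₗ[R]
      (Fin (b i) → R ⧸ J)) := by
  have hrange : LinearMap.range (Fintype.linearCombination R g) = I := by
    rw [Fintype.range_linearCombination, ← hg]
  have hmem : ∀ x, Fintype.linearCombination R g x ∈ I := fun x =>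
    hrange.le (LinearMap.mem_range_self _ x)
  have hε : Function.Surjective ((Fintype.linearCombination R g).codRestrict I hmem) := by
    rintro ⟨y, hy⟩
    obtain ⟨x, hx⟩ := hrange.ge hy
    exact ⟨x, Subtype.ext hx⟩
  have hε0 : Function.Exact (A 0).mulVecLin
      ((Fintype.linearCombination R g).codRestrict I hmem) := fun x =>
    Subtype.ext_iff.trans (h0 x)
  have key := ModuleCat.nonempty_tor_iso_of_lTensor_eq_zero (F := fun i => Fin (b i) → R)
    (fun j => (A j).mulVecLin) ((Fintype.linearCombination R g).codRestrict I hmem) hε hε0 h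
    (Q := R ⧸ J) (fun j => (A j).lTensor_mulVecLin_quotient_eq_zero J (hA j)) i
  exact key.map fun e =>
    e.toLinearEquiv.trans (TensorProduct.piScalarRight R R (R ⧸ J) (Fin (b i)))

end Tor

/-! ### Betti numbers of ideals with a linear resolution. -/

section Betti

open MvPolynomial

variable {k : Type*} [Field k] {n : ℕ}

/-- This makes a linear resolution minimal: its matrices have entries in the ideal of the variables.
-/
theorem MvPolynomial.IsHomogeneous.mem_span_X {σ R : Type*} [CommRing R] {p : MvPolynomial σ R}
    (hp : p.IsHomogeneous 1) : p ∈ Ideal.span (Set.range (X : σ → MvPolynomial σ R)) := by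
  rw [← Set.image_univ, MvPolynomial.mem_ideal_span_X_image]
  intro m hm
  by_contra! h
  have h0 : m = 0 := Finsupp.ext fun i => h i (Set.mem_univ i)
  have := hp (MvPolynomial.mem_support_iff.1 hm)
  simp [h0] at this

/-- The residue field of the polynomial ring at the origin. -/
noncomputable def MvPolynomial.quotientSpanXEquiv (σ k : Type*) [Field k] :
    (MvPolynomial σ k ⧸ Ideal.span (Set.range (X : σ → MvPolynomial σ k))) ≃ₐ[k] k :=
  (Ideal.quotientEquivAlgOfEq k (by
    refine le_antisymm (Ideal.span_le.2 ?_) fun p hp => ?_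
    · rintro _ ⟨i, rfl⟩
      exact aeval_X _ i
    · rw [← Set.image_univ, MvPolynomial.mem_ideal_span_X_image]
      intro m hm
      by_contra! h
      have h0 : m = 0 := Finsupp.ext fun i => h i (Set.mem_univ i)
      rw [h0, MvPolynomial.mem_support_iff] at hm
      refine hm ?_
      have hp : aeval (fun _ => (0 : k)) p = 0 := hp
      simpa [aeval_zero, constantCoeff_eq] using hp)).trans
    (Ideal.quotientKerAlgEquivOfSurjective (f := aeval (fun _ : σ => (0 : k)))
      fun c => ⟨C c, by simp⟩)

theorem ModuleCat.rank_restrictScalars_C {ι : Type*} [Fintype ι]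
    {M : ModuleCat (MvPolynomial (Fin n) k)}
    (e : M ≃ₗ[MvPolynomial (Fin n) k] (ι → MvPolynomial (Fin n) k ⧸
      Ideal.span (Set.range (X : Fin n → MvPolynomial (Fin n) k)))) :
    Module.rank k ((ModuleCat.restrictScalars (C : k →+* MvPolynomial (Fin n) k)).obj M) =
      Fintype.card ι := by
  let e₁ : ((ModuleCat.restrictScalars (C : k →+* MvPolynomial (Fin n) k)).obj M) ≃ₗ[k]
      (ι → MvPolynomial (Fin n) k ⧸
        Ideal.span (Set.range (X : Fin n → MvPolynomial (Fin n) k))) :=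
    { e.toAddEquiv with
      map_smul' := fun c x => (e.map_smul (C c) x).trans (by
        rw [← algebraMap_eq, algebraMap_smul]
        rfl) }
  have h := (e₁.trans (LinearEquiv.piCongrRight fun _ =>
    (quotientSpanXEquiv (Fin n) k).toLinearEquiv)).lift_rank_eq
  rw [rank_fun'] at h
  simpa using h

theorem bettiNumber_eq_of_linear_resolution {I : Ideal (MvPolynomial (Fin n) k)} (b : ℕ → ℕ)
    (g : Fin (b 0) → MvPolynomial (Fin n) k)
    (A : ∀ i : ℕ, Matrix (Fin (b i)) (Fin (b (i + 1))) (MvPolynomial (Fin n) k))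
    (hA : ∀ i r s, (A i r s).IsHomogeneous 1) (hg : Ideal.span (Set.range g) = I)
    (h0 : Function.Exact (A 0).mulVecLin (Fintype.linearCombination (MvPolynomial (Fin n) k) g))
    (h : ∀ i, Function.Exact (A (i + 1)).mulVecLin (A i).mulVecLin) (i : ℕ) :
    bettiNumber i (ModuleCat.of (MvPolynomial (Fin n) k) I) = b i := by
  obtain ⟨e⟩ := ModuleCat.nonempty_tor_equiv_of_matrix_resolution b g A hg h0 h
    (Ideal.span (Set.range (X : Fin n → MvPolynomial (Fin n) k)))
    (fun i r s => (hA i r s).mem_span_X) i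
  exact (ModuleCat.rank_restrictScalars_C e).trans (by rw [Fintype.card_fin])

end Betti

theorem theorem1p1 {k : Type*} [Field k] (n t : ℕ) (hn : 2 ≤ n) (ht : 1 ≤ t) :
    HasLinearFreeResolution (cyclePathIdeal k n (n - 1) ^ t) ∧
    ∀ i : ℕ,
      bettiNumber i (ModuleCat.of (MvPolynomial (Fin n) k) ↥(cyclePathIdeal k n (n - 1) ^ t)) =
        ((if i ≤ t then (n - 1).choose i * (n + t - i - 1).choose (t - i) else 0 : ℕ) :
          Cardinal) := by
  obtain ⟨N, rfl⟩ : ∃ N, n = N + 1 := ⟨n - 1, by omega⟩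
  rw [Nat.add_sub_cancel]
  obtain ⟨b, g, A, hb, hg, hA, hI, h0, h⟩ := exists_linear_resolution_cyclePathIdeal_pow (k := k)
    (N := N) t
  refine ⟨⟨N * t, b, g, A, hg, hA, hI, h0, h⟩, fun i => ?_⟩
  rw [bettiNumber_eq_of_linear_resolution b g A hA hI h0 h, hb]
  congr 1
  split_ifs with hi
  · congr 2
    -- Moving the truncated subtraction outwards needs i ≤ t.
    omega
  · rfl
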